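/- **Setting.** Let $\mathcal S$ be a finite state space partitioned into layers $\mathcal S=\mathcal S_1\cup\dots\cup\mathcal S_H$, let $\mathcal A$ be a finite action space, and let $\mathcal M^{\mathrm{sto}}$ be the set of all horizon-$H$ MDPs $M=(P,R,\mu)$ over them: the initial distribution $\mu$ is supported on $\mathcal S_1$, $P(\cdot\mid s,a)$ is supported on $\mathcal S_{h+1}$ for $s\in\mathcal S_h$, $h<H$, the reward distributions $R(s,a)$ are supported on $[0,1]$, and the cumulative reward of every trajectory is at most $1$. Write $V^\pi$ for the expected cumulative reward of a policy $\pi\in\mathcal A^{\mathcal S}$ in $M$. For a policy class $\Pi\subseteq\mathcal A^{\mathcal S}$, the *spanning capacity* $\mathfrak C(\Pi)$ is the maximum, over layers $h\in[H]$ and over MDPs with deterministic initial state, transitions and rewards, of the number of pairs $(s,a)$ that lie, at layer $h$, on the trajectory of some $\pi\in\Pi$. In the *generative model* a (possibly randomized) learner, to whom $M$ is unknown, adaptively queries pairs $(s,a)$ of its choice and observes independent samples $s'\sim P(\cdot\mid s,a)$ and $r\sim R(s,a)$ for each query; it may also draw initial states $s_1\sim\mu$, which are not counted as queries. Finally it returns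 a policy $\hat\pi\in\mathcal A^{\mathcal S}$. Let $n_{\mathsf{gen}}(\Pi;\epsilon,\delta)$ be the least $n$ for which some learner that makes at most $n$ queries satisfies, for every $M\in\mathcal M^{\mathrm{sto}}$, $V^{\hat\pi}\ge\max_{\pi\in\Pi}V^\pi-\epsilon$ with probability at least $1-\delta$. **Theorem.** For all $\epsilon_0<1$ and $\delta_0<1/2$ there is a constant $c>0$, depending only on $\epsilon_0$ and $\delta_0$, such that for all $H$, all finite layered $\mathcal S$, all finite $\mathcal A$, every policy class $\Pi\subseteq\mathcal A^{\mathcal S}$ with $\mathfrak C(\Pi)\ge 2$, and all $0<\epsilon\le\epsilon_0$ and $0<\delta\le\delta_0$, $$n_{\mathsf{gen}}(\Pi;\epsilon,\delta)\ \ge\ c\cdot\frac{\mathfrak C(\Pi)}{\epsilon^2}\cdot\log\frac1\delta .$$ -/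

import Mathlib

open MeasureTheory ProbabilityTheory
open scoped ENNReal

namespace AgnosticRL

universe u v

/-- Probability that a horizon-`H` trajectory visits the states `(τ h).1` when the actions
`(τ h).2` are played: `μ(s₁) ∏ P(s_{h+1} | s_h, a_h)`. (Layers are indexed from `0`.) -/
noncomputable def pathProb {H : ℕ} {S : Type u} {A : Type v}
    (init : PMF S) (trans : S → A → PMF S) (τ : Fin H → S × A) : ℝ≥0∞ :=
  ∏ h : Fin H,
    if 0 < h.val then
      trans (τ ⟨h.val - 1, lt_of_le_of_lt (Nat.sub_le _ _) h.isLt⟩).1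
        (τ ⟨h.val - 1, lt_of_le_of_lt (Nat.sub_le _ _) h.isLt⟩).2 (τ h).1
    else init (τ h).1

/-- Stochastic episodic MDPs of horizon `H` over the layered state space `S` (the state `s` is in
layer `layer s`) and the action space `A`. The next state of a state in the last layer plays no
role, so the transitions there are arbitrary. -/
structure MDP {H : ℕ} {S : Type u} (layer : S → Fin H) (A : Type v) where
  /-- initial distribution -/
  init : PMF S
  init_layer : ∀ s, init s ≠ 0 → (layer s : ℕ) = 0
  /-- transition kernel -/
  trans : S → A → PMF S
  trans_layer : ∀ s a s', trans s a s' ≠ 0 → (layer s : ℕ) + 1 < H →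
    (layer s' : ℕ) = (layer s : ℕ) + 1
  /-- reward distributions -/
  reward : S → A → Measure ℝ
  reward_prob : ∀ s a, IsProbabilityMeasure (reward s a)
  reward_mem : ∀ s a, ∀ᵐ r ∂(reward s a), r ∈ Set.Icc (0 : ℝ) 1
  /-- the cumulative reward of any trajectory that can occur is at most `1` -/
  cumulative_le_one : ∀ τ : Fin H → S × A, pathProb init trans τ ≠ 0 →
    ∀ᵐ r ∂(Measure.pi fun h => reward (τ h).1 (τ h).2), ∑ h, r h ≤ 1

attribute [instance] MDP.reward_prob

namespace MDP

variable {H : ℕ} {S : Type u} {layer : S → Fin H} {A : Type v}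

/-- Probability that running the deterministic policy `π` visits the states `σ`. -/
noncomputable def policyPathProb (M : MDP layer A) (π : S → A) (σ : Fin H → S) : ℝ≥0∞ :=
  pathProb M.init M.trans fun h => (σ h, π (σ h))

/-- Law of the trajectory `(s_h, a_h, r_h)_h` obtained by running `π`. -/
noncomputable def trajLaw [Fintype S] [MeasurableSpace S] [MeasurableSpace A]
    (M : MDP layer A) (π : S → A) : Measure (Fin H → S × A × ℝ) :=
  ∑ σ : Fin H → S, M.policyPathProb π σ •
    (Measure.pi fun h => M.reward (σ h) (π (σ h))).map fun r h => (σ h, π (σ h), r h)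

/-- `V^π`, the expected cumulative reward of `π`. -/
noncomputable def value [Fintype S] [MeasurableSpace S] [MeasurableSpace A]
    (M : MDP layer A) (π : S → A) : ℝ :=
  ∫ τ, ∑ h, (τ h).2.2 ∂(M.trajLaw π)

/-- Deterministic initial state, transitions and rewards. -/
def IsDeterministic (M : MDP layer A) : Prop :=
  (∃ s, M.init = PMF.pure s) ∧ (∀ s a, ∃ s', M.trans s a = PMF.pure s') ∧
    ∀ s a, ∃ r, M.reward s a = Measure.dirac r

/-- The state-action pairs that some policy of the class reaches at layer `h`. (In a deterministic
MDP exactly one `σ` has nonzero probability under `π`: the trajectory of `π`.) -/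
def reachable (M : MDP layer A) (Pol : Set (S → A)) (h : Fin H) : Set (S × A) :=
  {p | ∃ π ∈ Pol, ∃ σ : Fin H → S, M.policyPathProb π σ ≠ 0 ∧ p = (σ h, π (σ h))}

/-- Answer of the simulator to a query `(s, a)`: an independent pair `s' ∼ P(· | s, a)`,
`r ∼ R(s, a)`, recorded together with the query. If the learner passes (`Sum.inl ()`), nothing is
sampled. -/
noncomputable def simulator [Fintype S] [Fintype A] [MeasurableSpace S] [MeasurableSpace A]
    [MeasurableSingletonClass S] [MeasurableSingletonClass A] (M : MDP layer A) :
    Kernel (Unit ⊕ (S × A)) (Unit ⊕ ((S × A) × (S × ℝ))) where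
  toFun := Sum.elim (fun _ => Measure.dirac (Sum.inl ()))
    (fun p => ((M.trans p.1 p.2).toMeasure.prod (M.reward p.1 p.2)).map
      fun x => Sum.inr (p, x))
  measurable' := Measurable.sumElim (measurable_of_countable _) (measurable_of_countable _)

end MDP

/-- Spanning capacity: the maximum, over layers `h` and deterministic MDPs, of the number of
state-action pairs reachable by the class at layer `h`. (The set is bounded by `|S| |A|` when `S`
and `A` are finite.) -/
noncomputable def spanningCapacity {H : ℕ} {S : Type u} {A : Type v} (layer : S → Fin H)
    (Pol : Set (S → A)) : ℕ :=
  sSup {k | ∃ (h : Fin H) (M : MDP layer A), M.IsDeterministic ∧ k = (M.reachable Pol h).ncard}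

/-- What a learner has seen before round `t`: a sequence of draws from the initial distribution and
the records of the first `t` rounds. -/
abbrev History (S : Type u) (A : Type v) (t : ℕ) : Type (max u v) :=
  (ℕ → S) × (Fin t → Unit ⊕ ((S × A) × (S × ℝ)))

/-- A randomized adaptive learner making at most `n` queries to the simulator. In each of the rounds
`t < n` it either queries some `(s, a)` or passes (so it may stop early), at random depending on the
history; after round `n` it returns a policy. -/
structure Learner (S : Type u) (A : Type v) [MeasurableSpace S] [MeasurableSpace A] (n : ℕ) where
  query : ∀ t : ℕ, Kernel (History S A t) (Unit ⊕ (S × A))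
  query_markov : ∀ t, IsMarkovKernel (query t)
  output : Kernel (History S A n) (S → A)
  output_markov : IsMarkovKernel output

attribute [instance] Learner.query_markov Learner.output_markov

namespace Learner

variable {H : ℕ} {S : Type u} {A : Type v} [Fintype S] [Fintype A] [MeasurableSpace S]
  [MeasurableSpace A] [MeasurableSingletonClass S] [MeasurableSingletonClass A]
  {layer : S → Fin H} {n : ℕ}

/-- Law of the history before round `t` when the learner interacts with `M`. The draws from the
initial distribution are i.i.d. and are not counted as queries. -/
noncomputable def historyLaw (L : Learner S A n) (M : MDP layer A) :
    ∀ t : ℕ, Measure (History S A t)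
  | 0 => (Measure.infinitePi fun _ : ℕ => M.init.toMeasure).prod (Measure.dirac Fin.elim0)
  | t + 1 => (L.historyLaw M t ⊗ₘ (M.simulator ∘ₖ L.query t)).map
      fun x => (x.1.1, Fin.snoc x.1.2 x.2)

/-- Law of the returned policy. -/
noncomputable def outputLaw (L : Learner S A n) (M : MDP layer A) : Measure (S → A) :=
  L.output ∘ₘ L.historyLaw M n

/-- With probability at least `1 - δ` the returned policy is `ε`-optimal with respect to the class
`Pol` in the MDP `M`. -/
def IsPAC (L : Learner S A n) (M : MDP layer A) (Pol : Set (S → A)) (ε δ : ℝ) : Prop :=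
  ENNReal.ofReal (1 - δ) ≤ L.outputLaw M {π' | ∀ π ∈ Pol, M.value π - ε ≤ M.value π'}

end Learner

/-- Minimax sample complexity, with a generative model, of `(ε, δ)`-PAC learning the policy class
`Pol` over the class `𝓜` of MDPs: the least `n` such that some learner with at most `n` queries is
`(ε, δ)`-PAC for every MDP in `𝓜` (`⊤` if there is none). -/
noncomputable def nGen {H : ℕ} {S : Type u} {A : Type v} [Fintype S] [Fintype A]
    [MeasurableSpace S] [MeasurableSpace A] [MeasurableSingletonClass S]
    [MeasurableSingletonClass A] (layer : S → Fin H) (Pol : Set (S → A))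
    (𝓜 : Set (MDP layer A)) (ε δ : ℝ) : ℕ∞ :=
  sInf {m | ∃ n : ℕ, m = n ∧ ∃ L : Learner S A n, ∀ M ∈ 𝓜, L.IsPAC M Pol ε δ}

end AgnosticRL

open MeasureTheory ProbabilityTheory
open scoped ENNReal

namespace AgnosticRL

universe u v

/-! Fix a deterministic MDP and a layer `h` attaining the spanning capacity `D`. A policy follows a
single trajectory, so it reaches at most one pair at layer `h`; putting rewards on that layer only
turns policy learning into a bandit with `D` arms.

In the null instance all arms have mean `(1 - γ) / 2`; in the alternative for `i`, arm `i` is raised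
to `(1 + γ) / 2`. If `ε < γ < 1`, a PAC learner must output a policy reaching `i` with probability
at least `1 - δ` under that alternative (`Learner.IsPAC.le_real_reachingPolicies`). Under the null
these events are disjoint, so at most one has probability above `1 / 2`. Averaging over the others
gives an arm `i` with null probability at most `1 / 2` and at most `2 n / D` expected null queries
(`exists_le_half_and_card_mul_le`).

For this arm, the relative entropy of the null history law with respect to the alternative is `γ log
((1 + γ) / (1 - γ))` times the expected number of queries to `i`, by a Wald identity. By data
processing it is at least `kl(1 / 2, 1 - δ) = -(1 / 2) log (4 δ (1 - δ))` (`integral_logRatio_le`).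
Comparing the two (`Learner.neg_log_le_expectedQueries`) and taking `γ` proportional to `ε` yields
the rate. -/

/-! ### Real-variable estimates -/

/-- A log-likelihood ratio `Λ` under which a test `G` passes from mean at most `1 / 2` to mean at
least `1 - δ` has a very negative expectation. -/
theorem integral_logRatio_le {Ω : Type*} [MeasurableSpace Ω] {μ : Measure Ω}
    [IsProbabilityMeasure μ] {Λ G : Ω → ℝ} {δ : ℝ} (hδ : 0 < δ) (hδ' : δ < 1 / 2)
    (hΛ : Integrable Λ μ) (hexp : Integrable (fun x => Real.exp (Λ x)) μ)
    (hG : Integrable G μ) (hGexp : Integrable (fun x => G x * Real.exp (Λ x)) μ)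
    (hG0 : ∀ x, 0 ≤ G x) (hG1 : ∀ x, G x ≤ 1) (htot : ∫ x, Real.exp (Λ x) ∂μ = 1)
    (halt : 1 - δ ≤ ∫ x, G x * Real.exp (Λ x) ∂μ) (hnull : ∫ x, G x ∂μ ≤ 1 / 2) :
    ∫ x, Λ x ∂μ ≤ 1 / 2 * Real.log (4 * δ * (1 - δ)) := by
  have h1 : 0 < 1 - δ := by linarith
  -- `X` and `Y` are the inverse likelihood ratios, on acceptance and rejection, of Bernoulli laws
  -- with means `1 - δ` and `1 / 2`.
  set X : ℝ := 1 / (2 * (1 - δ)) with hX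
  set Y : ℝ := 1 / (2 * δ) with hY
  have hX0 : 0 < X := by positivity
  have hY0 : 0 < Y := by positivity
  -- Tangent line bound, tight at `exp u = 1 / w`. Using `w = X` with weight `G` and `w = Y` with
  -- weight `1 - G` gives data processing for a randomized test.
  have key : ∀ w : ℝ, 0 < w → ∀ u : ℝ, u ≤ w * Real.exp u - 1 - Real.log w := by
    intro w hw u
    have := Real.add_one_le_exp (u + Real.log w)
    rw [Real.exp_add, Real.exp_log hw] at this
    linarith
  have hpt : ∀ x, Λ x ≤ (X - Y) * (G x * Real.exp (Λ x)) + Y * Real.exp (Λ x)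
      + (Real.log Y - Real.log X) * G x - (1 + Real.log Y) := by
    intro x
    have a1 := mul_le_mul_of_nonneg_left (key X hX0 (Λ x)) (hG0 x)
    have a2 := mul_le_mul_of_nonneg_left (key Y hY0 (Λ x)) (sub_nonneg.2 (hG1 x))
    linarith
  have hint := integral_mono hΛ
    ((((hGexp.const_mul (X - Y)).add (hexp.const_mul Y)).add
      (hG.const_mul (Real.log Y - Real.log X))).sub (integrable_const (1 + Real.log Y))) hpt
  have hval : ∫ x, ((X - Y) * (G x * Real.exp (Λ x)) + Y * Real.exp (Λ x)
      + (Real.log Y - Real.log X) * G x - (1 + Real.log Y)) ∂μ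
      = (X - Y) * ∫ x, G x * Real.exp (Λ x) ∂μ + Y
        + (Real.log Y - Real.log X) * ∫ x, G x ∂μ - (1 + Real.log Y) := by
    rw [integral_sub, integral_add, integral_add, integral_const_mul, integral_const_mul,
      integral_const_mul, htot]
    · simp
    · exact hGexp.const_mul _
    · exact hexp.const_mul _
    · exact (hGexp.const_mul _).add (hexp.const_mul _)
    · exact hG.const_mul _
    · exact ((hGexp.const_mul _).add (hexp.const_mul _)).add (hG.const_mul _)
    · exact integrable_const _
  -- This order gives the two test means coefficients of the signs that `halt` and `hnull` require.
  have hXY : X ≤ Y := by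
    rw [hX, hY]
    exact one_div_le_one_div_of_le (by positivity) (by linarith)
  have hlog : Real.log X ≤ Real.log Y := Real.log_le_log hX0 hXY
  have e1 : (X - Y) * ∫ x, G x * Real.exp (Λ x) ∂μ ≤ (X - Y) * (1 - δ) :=
    mul_le_mul_of_nonpos_left halt (by linarith)
  have e2 : (Real.log Y - Real.log X) * ∫ x, G x ∂μ ≤ (Real.log Y - Real.log X) * (1 / 2) :=
    mul_le_mul_of_nonneg_left hnull (by linarith)
  have e3 : (X - Y) * (1 - δ) + Y = 1 := by
    rw [hX, hY]
    field_simp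
    ring
  have e4 : Real.log (4 * δ * (1 - δ)) = - Real.log X - Real.log Y := by
    have h : - Real.log X - Real.log Y = Real.log X⁻¹ + Real.log Y⁻¹ := by
      rw [Real.log_inv, Real.log_inv]
      ring
    rw [h, ← Real.log_mul (by positivity) (by positivity), hX, hY]
    congr 1
    field_simp
    norm_num
  have : ∫ x, Λ x ∂μ ≤ _ := hint.trans hval.le
  rw [e4]
  linarith

/-- `log (1 / (4 δ (1 - δ)))` is of order `log (1 / δ)`, uniformly for `δ ≤ δ₀ < 1 / 2`. -/
theorem exists_mul_log_le {δ₀ : ℝ} (h0 : 0 < δ₀) (hδ₀ : δ₀ < 1 / 2) :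
    ∃ c : ℝ, 0 < c ∧ ∀ δ : ℝ, 0 < δ → δ ≤ δ₀ →
      c * Real.log (1 / δ) ≤ - Real.log (4 * δ * (1 - δ)) := by
  set K := - Real.log (4 * δ₀ * (1 - δ₀)) with hK
  have hK0 : 0 < K := by
    have : Real.log (4 * δ₀ * (1 - δ₀)) < 0 :=
      Real.log_neg (by nlinarith) (by nlinarith [mul_pos (sub_pos.2 hδ₀) (sub_pos.2 hδ₀)])
    linarith
  have hl4 : 0 < Real.log 4 := Real.log_pos (by norm_num)
  -- The right-hand side is at least `log (1 / δ) - log 4`, and at least `K` by monotonicity; the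
  -- second bound absorbs `log 4`.
  refine ⟨(1 + Real.log 4 / K)⁻¹, by positivity, fun δ hδ hle => ?_⟩
  rw [inv_mul_le_iff₀ (by positivity)]
  have h1 : K ≤ - Real.log (4 * δ * (1 - δ)) := by
    rw [hK, neg_le_neg_iff]
    exact Real.log_le_log (by nlinarith) (by nlinarith)
  have h2 : Real.log (1 / δ) - Real.log 4 ≤ - Real.log (4 * δ * (1 - δ)) := by
    rw [one_div, Real.log_inv]
    have : Real.log (4 * δ * (1 - δ)) ≤ Real.log (4 * δ) :=
      Real.log_le_log (by nlinarith) (by nlinarith)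
    rw [Real.log_mul (by norm_num) hδ.ne'] at this
    linarith
  have h3 : Real.log 4 ≤ Real.log 4 / K * (- Real.log (4 * δ * (1 - δ))) := by
    calc Real.log 4 = Real.log 4 / K * K := by field_simp
      _ ≤ _ := by gcongr
  linarith

/-- Among at least two items, one has both weight `q` at most `1 / 2` and cost `N` at most twice
the average. -/
theorem exists_le_half_and_card_mul_le {ι : Type*} (T : Finset ι) (hT : 2 ≤ T.card)
    (q N : ι → ℝ) (hq : ∀ i ∈ T, 0 ≤ q i) (hN : ∀ i ∈ T, 0 ≤ N i) {n : ℝ}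
    (hqs : ∑ i ∈ T, q i ≤ 1) (hNs : ∑ i ∈ T, N i ≤ n) :
    ∃ i ∈ T, q i ≤ 1 / 2 ∧ T.card * N i ≤ 2 * n := by
  classical
  by_contra! hcon
  have hD : (2 : ℝ) ≤ T.card := by exact_mod_cast hT
  have hbig : (T.filter fun i => ¬ q i ≤ 1 / 2).card ≤ 1 := by
    rw [Finset.card_le_one]
    intro i hi j hj
    by_contra hij
    simp only [Finset.mem_filter, not_le] at hi hj
    have hsub : ∑ k ∈ ({i, j} : Finset ι), q k ≤ ∑ k ∈ T, q k :=
      Finset.sum_le_sum_of_subset_of_nonneg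
        (by intro k hk; simp only [Finset.mem_insert, Finset.mem_singleton] at hk
            rcases hk with rfl | rfl; exacts [hi.1, hj.1])
        (fun k hk _ => hq k hk)
    rw [Finset.sum_pair hij] at hsub
    linarith [hi.2, hj.2]
  set F := T.filter fun i => q i ≤ 1 / 2 with hF
  have hcard : F.card + (T.filter fun i => ¬ q i ≤ 1 / 2).card = T.card :=
    Finset.card_filter_add_card_filter_not _
  -- With `2 ≤ T.card` this gives `T.card ≤ 2 * F.card`, the source of the factor `2` in the cost
  -- bound.
  have hFc : T.card ≤ F.card + 1 := by omega
  have hFne : F.Nonempty := by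
    rw [← Finset.card_pos]; omega
  have hFr : (T.card : ℝ) ≤ F.card + 1 := by exact_mod_cast hFc
  have hlt : ∑ _i ∈ F, 2 * n < ∑ i ∈ F, T.card * N i :=
    Finset.sum_lt_sum_of_nonempty hFne fun i hi => by
      rw [hF, Finset.mem_filter] at hi
      exact hcon i hi.1 hi.2
  have hle : ∑ i ∈ F, N i ≤ ∑ i ∈ T, N i :=
    Finset.sum_le_sum_of_subset_of_nonneg (Finset.filter_subset _ _) fun i hi _ => hN i hi
  rw [Finset.sum_const, nsmul_eq_mul, ← Finset.mul_sum] at hlt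
  have hn : 0 ≤ n := (Finset.sum_nonneg hN).trans hNs
  nlinarith

/-! ### Change of measure for interaction histories -/

theorem measurable_history_snoc {S : Type u} {A : Type v} [MeasurableSpace S]
    [MeasurableSpace A] (t : ℕ) :
    Measurable fun x : History S A t × (Unit ⊕ ((S × A) × (S × ℝ))) =>
      ((x.1.1, Fin.snoc x.1.2 x.2) : History S A (t + 1)) := by
  refine Measurable.prodMk (by fun_prop) (measurable_pi_iff.2 fun k => ?_)
  refine Fin.lastCases ?_ (fun j => ?_) k
  · simp only [Fin.snoc_last]
    fun_prop
  · simp only [Fin.snoc_castSucc]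
    fun_prop

section Histories

variable {H : ℕ} {S : Type u} {A : Type v} [Fintype S] [Fintype A] [MeasurableSpace S]
  [MeasurableSpace A] [MeasurableSingletonClass S] [MeasurableSingletonClass A]
  {layer : S → Fin H} {n : ℕ}

theorem MDP.simulator_inl (M : MDP layer A) (u : Unit) :
    M.simulator (Sum.inl u) = Measure.dirac (Sum.inl ()) := rfl

theorem MDP.simulator_inr (M : MDP layer A) (p : S × A) :
    M.simulator (Sum.inr p) = ((M.trans p.1 p.2).toMeasure.prod (M.reward p.1 p.2)).map
      fun x => Sum.inr (p, x) := rfl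

instance MDP.isMarkovKernel_simulator (M : MDP layer A) : IsMarkovKernel M.simulator := by
  refine ⟨fun q => ?_⟩
  rcases q with u | p
  · rw [MDP.simulator_inl]
    infer_instance
  · rw [MDP.simulator_inr]
    exact Measure.isProbabilityMeasure_map (by fun_prop)

instance Learner.isProbabilityMeasure_historyLaw (L : Learner S A n) (M : MDP layer A) (t : ℕ) :
    IsProbabilityMeasure (L.historyLaw M t) := by
  induction t with
  | zero =>
    rw [Learner.historyLaw]
    infer_instance
  | succ t ih =>
    rw [Learner.historyLaw]
    exact Measure.isProbabilityMeasure_map (measurable_history_snoc t).aemeasurable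

theorem Learner.lintegral_historyLaw_succ (L : Learner S A n) (M : MDP layer A) (t : ℕ)
    {f : History S A (t + 1) → ℝ≥0∞} (hf : Measurable f) :
    ∫⁻ x, f x ∂(L.historyLaw M (t + 1)) =
      ∫⁻ x, ∫⁻ q, ∫⁻ y, f (x.1, Fin.snoc x.2 y) ∂(M.simulator q) ∂(L.query t x)
        ∂(L.historyLaw M t) := by
  have hm := measurable_history_snoc (S := S) (A := A) t
  rw [Learner.historyLaw, lintegral_map hf hm]
  refine (Measure.lintegral_compProd (hf.comp hm)).trans ?_
  refine lintegral_congr fun x => ?_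
  exact Kernel.lintegral_comp _ _ _ ((hf.comp hm).comp measurable_prodMk_left)

/-- If the simulator of `M'` has density `exp ∘ l` with respect to the simulator of `M`, then the
law of the history has the product density. -/
theorem Learner.lintegral_historyLaw_eq (L : Learner S A n) (M M' : MDP layer A)
    (hinit : M'.init = M.init) {l : Unit ⊕ ((S × A) × (S × ℝ)) → ℝ} (hl : Measurable l)
    (hsim : ∀ q (f : Unit ⊕ ((S × A) × (S × ℝ)) → ℝ≥0∞), Measurable f →
      ∫⁻ y, f y ∂(M'.simulator q) = ∫⁻ y, ENNReal.ofReal (Real.exp (l y)) * f y ∂(M.simulator q))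
    (t : ℕ) {f : History S A t → ℝ≥0∞} (hf : Measurable f) :
    ∫⁻ x, f x ∂(L.historyLaw M' t) =
      ∫⁻ x, ENNReal.ofReal (Real.exp (∑ k, l (x.2 k))) * f x ∂(L.historyLaw M t) := by
  induction t with
  | zero => simp [Learner.historyLaw, hinit]
  | succ t ih =>
    have hm := measurable_history_snoc (S := S) (A := A) t
    have hw : Measurable fun x : History S A (t + 1) =>
        ENNReal.ofReal (Real.exp (∑ k, l (x.2 k))) * f x := by fun_prop
    have hfm : ∀ x : History S A t, Measurable fun y => f (x.1, Fin.snoc x.2 y) := fun x =>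
      (hf.comp hm).comp measurable_prodMk_left
    rw [L.lintegral_historyLaw_succ M' t hf, L.lintegral_historyLaw_succ M t hw, ih]
    -- The learner's query kernel is the same in both MDPs, so each round contributes only the
    -- simulator's density.
    · refine lintegral_congr fun x => ?_
      rw [← lintegral_const_mul]
      · refine lintegral_congr fun q => ?_
        rw [hsim q _ (hfm x), ← lintegral_const_mul]
        · refine lintegral_congr fun y => ?_
          dsimp only
          rw [Fin.sum_univ_castSucc, ← mul_assoc]
          simp only [Fin.snoc_castSucc, Fin.snoc_last]
          rw [Real.exp_add, ENNReal.ofReal_mul (Real.exp_nonneg _)]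
        · exact (hl.exp.ennreal_ofReal).mul (hfm x)
      · exact Measurable.lintegral_kernel (hfm x)
    -- The induction hypothesis needs the iterated integral to be measurable in the history; this is
    -- seen by integrating against the composed kernel.
    · have h1 : Measurable fun x : History S A t =>
          ∫⁻ y, f (x.1, Fin.snoc x.2 y) ∂((M'.simulator ∘ₖ L.query t) x) :=
        Measurable.lintegral_kernel_prod_right' (hf.comp hm)
      convert h1 using 2 with x
      exact (Kernel.lintegral_comp _ _ _ (hfm x)).symm

/-- A bounded function of the records that is centred for every query has centred sums. -/
theorem Learner.integral_sum_record_eq_zero (L : Learner S A n) (M : MDP layer A)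
    {g : Unit ⊕ ((S × A) × (S × ℝ)) → ℝ} (hg : Measurable g) {C : ℝ} (hC : ∀ y, |g y| ≤ C)
    (hsim : ∀ q, ∫ y, g y ∂(M.simulator q) = 0) (t : ℕ) :
    ∫ x, ∑ k, g (x.2 k) ∂(L.historyLaw M t) = 0 := by
  have hint : ∀ s, Integrable (fun x : History S A s => ∑ k, g (x.2 k)) (L.historyLaw M s) := by
    intro s
    refine integrable_finsetSum _ fun k _ => ?_
    exact Integrable.of_bound
      (hg.comp ((measurable_pi_apply k).comp measurable_snd)).aestronglyMeasurable C (ae_of_all _ fun x => hC _)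
  have hgi : ∀ (m : Measure (Unit ⊕ ((S × A) × (S × ℝ)))) [IsProbabilityMeasure m],
      Integrable g m := fun m _ =>
    Integrable.of_bound hg.aestronglyMeasurable C (ae_of_all _ fun x => hC _)
  induction t with
  | zero => simp
  | succ t ih =>
    have hm := measurable_history_snoc (S := S) (A := A) t
    have hi := hint (t + 1)
    rw [Learner.historyLaw] at hi ⊢
    rw [integral_map hm.aemeasurable hi.aestronglyMeasurable]
    refine (Measure.integral_compProd (hi.comp_measurable hm)).trans ?_
    -- Given the past, the newest summand has mean zero whatever the query law, so only the earlier
    -- sum remains.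
    refine Eq.trans (integral_congr_ae (ae_of_all _ fun x => ?_)) ih
    simp only [Function.comp_apply, Fin.sum_univ_castSucc, Fin.snoc_castSucc, Fin.snoc_last]
    rw [integral_add (integrable_const _) (hgi _), integral_const,
      Kernel.integral_comp (hgi _)]
    simp [hsim]

end Histories

/-! ### Trajectories of deterministic MDPs -/

section Trajectories

variable {H : ℕ} {S : Type u} {A : Type v} {layer : S → Fin H}

theorem MDP.layer_eq_of_pathProb_ne_zero (M : MDP layer A) {τ : Fin H → S × A}
    (hτ : pathProb M.init M.trans τ ≠ 0) (k : Fin H) : layer (τ k).1 = k := by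
  have hfac := fun k => Finset.prod_ne_zero_iff.1 hτ k (Finset.mem_univ k)
  obtain ⟨k, hk⟩ := k
  induction k with
  | zero =>
    have := hfac ⟨0, hk⟩
    simp only [lt_irrefl, if_false] at this
    exact Fin.ext (M.init_layer _ this)
  | succ k ih =>
    have h0 := hfac ⟨k + 1, hk⟩
    simp only [Nat.succ_pos, if_true, Nat.add_sub_cancel] at h0
    have hl := ih (by omega)
    have := M.trans_layer _ _ _ h0 (by rw [hl]; exact hk)
    rw [hl] at this
    exact Fin.ext this

theorem MDP.policyPathProb_eq_one (M : MDP layer A) (hM : M.IsDeterministic) {π : S → A}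
    {σ : Fin H → S} (hσ : M.policyPathProb π σ ≠ 0) : M.policyPathProb π σ = 1 := by
  have hpure : ∀ (s t : S), PMF.pure s t ≠ 0 → PMF.pure s t = 1 := by
    intro s t h
    rw [PMF.pure_apply] at h ⊢
    split_ifs at h ⊢ <;> simp_all
  rw [MDP.policyPathProb, pathProb] at hσ ⊢
  refine Finset.prod_eq_one fun k _ => ?_
  have hfac := Finset.prod_ne_zero_iff.1 hσ k (Finset.mem_univ k)
  split_ifs at hfac ⊢ with hk
  · obtain ⟨s', hs'⟩ := hM.2.1 (σ ⟨k.val - 1, lt_of_le_of_lt (Nat.sub_le _ _) k.isLt⟩)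
      (π (σ ⟨k.val - 1, lt_of_le_of_lt (Nat.sub_le _ _) k.isLt⟩))
    simp only [hs'] at hfac ⊢
    exact hpure _ _ hfac
  · obtain ⟨s, hs⟩ := hM.1
    simp only [hs] at hfac ⊢
    exact hpure _ _ hfac

theorem MDP.eq_of_policyPathProb_ne_zero (M : MDP layer A) (hM : M.IsDeterministic) {π : S → A}
    {σ σ' : Fin H → S} (hσ : M.policyPathProb π σ ≠ 0) (hσ' : M.policyPathProb π σ' ≠ 0) :
    σ = σ' := by
  have hpure : ∀ (s t : S), PMF.pure s t ≠ 0 → t = s := by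
    intro s t h
    rw [PMF.pure_apply] at h
    by_contra hne
    exact h (if_neg hne)
  rw [MDP.policyPathProb, pathProb] at hσ hσ'
  have hfac := fun k => Finset.prod_ne_zero_iff.1 hσ k (Finset.mem_univ k)
  have hfac' := fun k => Finset.prod_ne_zero_iff.1 hσ' k (Finset.mem_univ k)
  funext k
  obtain ⟨k, hk⟩ := k
  induction k with
  | zero =>
    obtain ⟨s, hs⟩ := hM.1
    have h1 := hfac ⟨0, hk⟩
    have h2 := hfac' ⟨0, hk⟩
    simp only [lt_irrefl, if_false, hs] at h1 h2
    rw [hpure _ _ h1, hpure _ _ h2]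
  | succ k ih =>
    have h1 := hfac ⟨k + 1, hk⟩
    have h2 := hfac' ⟨k + 1, hk⟩
    simp only [Nat.succ_pos, if_true, Nat.add_sub_cancel] at h1 h2
    rw [← ih (by omega)] at h2
    obtain ⟨s', hs'⟩ := hM.2.1 (σ ⟨k, by omega⟩) (π (σ ⟨k, by omega⟩))
    rw [hs'] at h1 h2
    rw [hpure _ _ h1, hpure _ _ h2]

/-- The policies that reach the pair `p` at layer `h`. -/
def MDP.reachingPolicies (M : MDP layer A) (h : Fin H) (p : S × A) : Set (S → A) :=
  {π | ∃ σ : Fin H → S, M.policyPathProb π σ ≠ 0 ∧ p = (σ h, π (σ h))}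

/-- Uniqueness of the trajectory makes the events of reaching different arms disjoint, so their
probabilities sum to at most one. -/
theorem MDP.eq_of_mem_reachingPolicies (M : MDP layer A) (hM : M.IsDeterministic) {h : Fin H}
    {p p' : S × A} {π : S → A} (hp : π ∈ M.reachingPolicies h p)
    (hp' : π ∈ M.reachingPolicies h p') : p = p' := by
  obtain ⟨σ, hσ, rfl⟩ := hp
  obtain ⟨σ', hσ', rfl⟩ := hp'
  rw [M.eq_of_policyPathProb_ne_zero hM hσ hσ']

theorem MDP.layer_eq_of_mem_reachable {M : MDP layer A} {Pol : Set (S → A)} {h : Fin H}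
    {i : S × A} (hi : i ∈ M.reachable Pol h) : layer i.1 = h := by
  obtain ⟨π, -, σ, hσ, rfl⟩ := hi
  exact M.layer_eq_of_pathProb_ne_zero hσ h

end Trajectories

theorem exists_reachable_ncard_eq_spanningCapacity {H : ℕ} {S : Type u} {A : Type v} [Finite S]
    [Finite A] {layer : S → Fin H} {Pol : Set (S → A)} (hC : 2 ≤ spanningCapacity layer Pol) :
    ∃ (h : Fin H) (M : MDP layer A), M.IsDeterministic ∧
      spanningCapacity layer Pol = (M.reachable Pol h).ncard := by
  have hbdd : BddAbove {k | ∃ (h : Fin H) (M : MDP layer A), M.IsDeterministic ∧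
      k = (M.reachable Pol h).ncard} := by
    refine ⟨Nat.card (S × A), ?_⟩
    rintro k ⟨h, M, -, rfl⟩
    exact Set.ncard_le_card _
  refine Nat.sSup_mem (Set.nonempty_iff_ne_empty.2 fun he => ?_) hbdd
  -- The supremum of the empty set is `0` in `ℕ`, contradicting `hC`.
  rw [spanningCapacity, he, csSup_empty] at hC
  exact absurd hC (by decide)

/-! ### Bernoulli rewards at a single layer -/

/-- Bernoulli distribution on the reals with mean `p`. -/
noncomputable def bernoulliReward (p : ℝ) : Measure ℝ :=
  ENNReal.ofReal (1 - p) • Measure.dirac 0 + ENNReal.ofReal p • Measure.dirac 1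

theorem isProbabilityMeasure_bernoulliReward {p : ℝ} (hp : p ∈ Set.Icc (0 : ℝ) 1) :
    IsProbabilityMeasure (bernoulliReward p) := by
  refine ⟨?_⟩
  simp only [bernoulliReward, Measure.coe_add, Measure.coe_smul, Pi.add_apply, Pi.smul_apply,
    measure_univ, smul_eq_mul, mul_one]
  rw [← ENNReal.ofReal_add (sub_nonneg.2 hp.2) hp.1]
  simp

theorem lintegral_bernoulliReward (p : ℝ) (f : ℝ → ℝ≥0∞) :
    ∫⁻ r, f r ∂(bernoulliReward p) =
      ENNReal.ofReal (1 - p) * f 0 + ENNReal.ofReal p * f 1 := by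
  simp [bernoulliReward, lintegral_add_measure]

theorem integrable_bernoulliReward (p : ℝ) (f : ℝ → ℝ) : Integrable f (bernoulliReward p) :=
  ((integrable_dirac (by simp)).smul_measure ENNReal.ofReal_ne_top).add_measure
    ((integrable_dirac (by simp)).smul_measure ENNReal.ofReal_ne_top)

theorem integral_bernoulliReward {p : ℝ} (hp : p ∈ Set.Icc (0 : ℝ) 1) (f : ℝ → ℝ) :
    ∫ r, f r ∂(bernoulliReward p) = (1 - p) * f 0 + p * f 1 := by
  rw [bernoulliReward, integral_add_measure
    ((integrable_dirac (by simp)).smul_measure ENNReal.ofReal_ne_top)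
    ((integrable_dirac (by simp)).smul_measure ENNReal.ofReal_ne_top)]
  simp [ENNReal.toReal_ofReal hp.1, ENNReal.toReal_ofReal (sub_nonneg.2 hp.2)]

theorem ae_bernoulliReward {p : ℝ} {P : ℝ → Prop} (h0 : P 0) (h1 : 0 < p → P 1) :
    ∀ᵐ r ∂(bernoulliReward p), P r := by
  rw [bernoulliReward, ae_add_measure_iff]
  constructor
  · exact Measure.ae_smul_measure (by simpa using h0) _
  · by_cases hp : 0 < p
    · exact Measure.ae_smul_measure (by simpa using h1 hp) _
    · simp [ENNReal.ofReal_of_nonpos (not_lt.1 hp)]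

section Bandit

variable {H : ℕ} {S : Type u} {A : Type v} {layer : S → Fin H}

theorem ite_mem_Icc {P : Prop} [Decidable P] {x : ℝ} (hx : x ∈ Set.Icc (0 : ℝ) 1) :
    (if P then x else 0) ∈ Set.Icc (0 : ℝ) 1 := by
  split_ifs
  · exact hx
  · simp

/-- The MDP with the dynamics of `M`, and a Bernoulli reward of mean `v (s, a)` for the pairs
`(s, a)` of layer `h` only. -/
noncomputable def MDP.bandit (M : MDP layer A) (h : Fin H) (v : S × A → ℝ)
    (hv : ∀ p, v p ∈ Set.Icc (0 : ℝ) 1) : MDP layer A where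
  init := M.init
  init_layer := M.init_layer
  trans := M.trans
  trans_layer := M.trans_layer
  reward s a := bernoulliReward (if layer s = h then v (s, a) else 0)
  reward_prob s a := isProbabilityMeasure_bernoulliReward (ite_mem_Icc (hv _))
  reward_mem s a := ae_bernoulliReward (by simp) (by simp)
  cumulative_le_one := by
    intro τ hτ
    have hprob := fun k : Fin H => isProbabilityMeasure_bernoulliReward
      (ite_mem_Icc (P := layer (τ k).1 = h) (hv ((τ k).1, (τ k).2)))
    -- A trajectory that can occur is in layer `h` only at step `h`; every other reward is Bernoulli
    -- of mean `0`.
    have hae : ∀ k : Fin H, ∀ᵐ r ∂(Measure.pi fun k : Fin H =>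
        bernoulliReward (if layer (τ k).1 = h then v ((τ k).1, (τ k).2) else 0)),
        r k ≤ if k = h then 1 else 0 := by
      intro k
      refine (Measure.tendsto_eval_ae_ae (μ := fun k : Fin H => bernoulliReward
        (if layer (τ k).1 = h then v ((τ k).1, (τ k).2) else 0)) (i := k)).eventually
        (p := fun x : ℝ => x ≤ if k = h then 1 else 0) (ae_bernoulliReward ?_ ?_)
      · split_ifs <;> simp
      · rw [M.layer_eq_of_pathProb_ne_zero hτ k]
        split_ifs <;> simp
    filter_upwards [ae_all_iff.2 hae] with r hr
    calc ∑ k, r k ≤ ∑ k, if k = h then 1 else 0 := Finset.sum_le_sum fun k _ => hr k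
      _ = 1 := by simp

variable [Fintype S] [MeasurableSpace S] [MeasurableSpace A]

/-- The sum over trajectories has one nonzero term, of weight one, and only its step `h` carries
reward: the value of a policy is the mean of its arm. -/
theorem MDP.value_bandit_of_ne_zero (M : MDP layer A) (hM : M.IsDeterministic)
    (h : Fin H) (v : S × A → ℝ) (hv : ∀ p, v p ∈ Set.Icc (0 : ℝ) 1) {π : S → A} {σ : Fin H → S}
    (hσ : M.policyPathProb π σ ≠ 0) : (M.bandit h v hv).value π = v (σ h, π (σ h)) := by
  classical
  have hsum : (M.bandit h v hv).trajLaw π = (Measure.pi fun k => (M.bandit h v hv).reward (σ k)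
      (π (σ k))).map fun r k => (σ k, π (σ k), r k) := by
    rw [MDP.trajLaw, Finset.sum_eq_single σ]
    · have : (M.bandit h v hv).policyPathProb π σ = 1 := M.policyPathProb_eq_one hM hσ
      rw [this, one_smul]
    · intro σ' _ hne
      have : (M.bandit h v hv).policyPathProb π σ' = 0 := by
        by_contra h0
        exact hne (M.eq_of_policyPathProb_ne_zero hM h0 hσ)
      rw [this, zero_smul]
    · simp
  have hmem := fun k : Fin H => ite_mem_Icc (P := layer (σ k) = h) (hv (σ k, π (σ k)))
  have hprob := fun k => isProbabilityMeasure_bernoulliReward (hmem k)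
  rw [MDP.value, hsum, integral_map
    (measurable_pi_iff.2 fun k => measurable_const.prodMk
      (measurable_const.prodMk (measurable_pi_apply k))).aemeasurable
    (Finset.measurable_sum _ fun k _ =>
      (measurable_pi_apply k).snd.snd).aestronglyMeasurable]
  change ∫ r, ∑ k, r k ∂(Measure.pi fun k : Fin H =>
    bernoulliReward (if layer (σ k) = h then v (σ k, π (σ k)) else 0)) = _
  rw [integral_finsetSum]
  · have hl := M.layer_eq_of_pathProb_ne_zero hσ
    have : ∀ k : Fin H, ∫ r, r k ∂(Measure.pi fun k : Fin H =>
        bernoulliReward (if layer (σ k) = h then v (σ k, π (σ k)) else 0)) =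
        if k = h then v (σ k, π (σ k)) else 0 := by
      intro k
      rw [integral_comp_eval (μ := fun k : Fin H =>
        bernoulliReward (if layer (σ k) = h then v (σ k, π (σ k)) else 0)) (i := k)
        (f := fun r : ℝ => r) (by fun_prop), integral_bernoulliReward (hmem k)]
      simp only [mul_zero, zero_add, mul_one, hl k]
    simp [this]
  · intro k _
    exact integrable_comp_eval (μ := fun k : Fin H =>
        bernoulliReward (if layer (σ k) = h then v (σ k, π (σ k)) else 0)) (i := k)
        (f := fun r : ℝ => r) (integrable_bernoulliReward _ _)

theorem MDP.value_bandit_le (M : MDP layer A) (hM : M.IsDeterministic)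
    (h : Fin H) (v : S × A → ℝ) (hv : ∀ p, v p ∈ Set.Icc (0 : ℝ) 1) {π : S → A} {c : ℝ}
    (hc : 0 ≤ c) (hvc : ∀ p, π ∈ M.reachingPolicies h p → v p ≤ c) :
    (M.bandit h v hv).value π ≤ c := by
  by_cases hex : ∃ σ, M.policyPathProb π σ ≠ 0
  · obtain ⟨σ, hσ⟩ := hex
    rw [M.value_bandit_of_ne_zero hM h v hv hσ]
    exact hvc _ ⟨σ, hσ, rfl⟩
  -- With no path of nonzero probability the trajectory law would be the zero measure and the value
  -- `0`; this spares proving that a path exists.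
  · push Not at hex
    have : (M.bandit h v hv).trajLaw π = 0 := by
      rw [MDP.trajLaw]
      refine Finset.sum_eq_zero fun σ _ => ?_
      have : (M.bandit h v hv).policyPathProb π σ = 0 := hex σ
      rw [this, zero_smul]
    rw [MDP.value, this, integral_zero_measure]
    exact hc

variable [Fintype A] [MeasurableSingletonClass S] [MeasurableSingletonClass A]

theorem MDP.lintegral_simulator_bandit (M : MDP layer A) (h : Fin H) (v : S × A → ℝ)
    (hv : ∀ p, v p ∈ Set.Icc (0 : ℝ) 1) (p : S × A)
    {f : Unit ⊕ ((S × A) × (S × ℝ)) → ℝ≥0∞} (hf : Measurable f) :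
    ∫⁻ y, f y ∂((M.bandit h v hv).simulator (Sum.inr p)) =
      ∫⁻ s, (ENNReal.ofReal (1 - if layer p.1 = h then v p else 0) * f (Sum.inr (p, (s, 0))) +
        ENNReal.ofReal (if layer p.1 = h then v p else 0) * f (Sum.inr (p, (s, 1))))
          ∂(M.trans p.1 p.2).toMeasure := by
  have hm : Measurable fun x : S × ℝ => (Sum.inr (p, x) : Unit ⊕ ((S × A) × (S × ℝ))) := by
    fun_prop
  rw [MDP.simulator_inr, lintegral_map hf hm]
  refine (lintegral_prod _ (hf.comp hm).aemeasurable).trans ?_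
  exact lintegral_congr fun s => lintegral_bernoulliReward _ _

theorem MDP.integral_simulator_bandit (M : MDP layer A) (h : Fin H) (v : S × A → ℝ)
    (hv : ∀ p, v p ∈ Set.Icc (0 : ℝ) 1) (p : S × A)
    {f : Unit ⊕ ((S × A) × (S × ℝ)) → ℝ} (hf : Measurable f) {C : ℝ} (hC : ∀ y, |f y| ≤ C) :
    ∫ y, f y ∂((M.bandit h v hv).simulator (Sum.inr p)) =
      ∫ s, ((1 - if layer p.1 = h then v p else 0) * f (Sum.inr (p, (s, 0))) +
        (if layer p.1 = h then v p else 0) * f (Sum.inr (p, (s, 1))))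
          ∂(M.trans p.1 p.2).toMeasure := by
  have hm : Measurable fun x : S × ℝ => (Sum.inr (p, x) : Unit ⊕ ((S × A) × (S × ℝ))) := by
    fun_prop
  rw [MDP.simulator_inr, integral_map hm.aemeasurable hf.aestronglyMeasurable, integral_prod]
  · exact integral_congr_ae (ae_of_all _ fun s =>
      integral_bernoulliReward (ite_mem_Icc (hv p)) fun r => f (Sum.inr (p, (s, r))))
  · exact Integrable.of_bound (hf.comp hm).aestronglyMeasurable C (ae_of_all _ fun x => hC _)

end Bandit

/-! ### The hard instances -/

section HardInstances

variable {H : ℕ} {S : Type u} {A : Type v} {layer : S → Fin H}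

/-- The instance in which all arms have mean `(1 - γ) / 2`. -/
noncomputable def MDP.nullInstance (M : MDP layer A) (h : Fin H) (γ : ℝ) (h0 : 0 < γ)
    (h1 : γ < 1) : MDP layer A :=
  M.bandit h (fun _ => (1 - γ) / 2) fun _ => Set.mem_Icc.2 ⟨by linarith, by linarith⟩

open Classical in
/-- The instance in which the arm `i` has mean `(1 + γ) / 2` and all others `(1 - γ) / 2`. -/
noncomputable def MDP.armInstance (M : MDP layer A) (h : Fin H) (γ : ℝ) (h0 : 0 < γ)
    (h1 : γ < 1) (i : S × A) : MDP layer A :=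
  M.bandit h (fun p => if p = i then (1 + γ) / 2 else (1 - γ) / 2) fun p => by
    split_ifs <;> constructor <;> linarith

open Classical in
/-- Log-likelihood ratio of a record between `armInstance` and `nullInstance`. -/
noncomputable def logRatio (γ : ℝ) (i : S × A) : Unit ⊕ ((S × A) × (S × ℝ)) → ℝ :=
  Sum.elim 0 fun z => if z.1 = i then
    (if z.2.2 = 1 then Real.log ((1 + γ) / (1 - γ)) else - Real.log ((1 + γ) / (1 - γ))) else 0

open Classical in
/-- Indicator of the records of queries to the arm `i`. -/
noncomputable def queryIndicator (i : S × A) : Unit ⊕ ((S × A) × (S × ℝ)) → ℝ :=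
  Sum.elim 0 fun z => if z.1 = i then 1 else 0

theorem queryIndicator_nonneg (i : S × A) (y) : 0 ≤ queryIndicator i y := by
  rcases y with u | z
  · simp [queryIndicator]
  · simp only [queryIndicator, Sum.elim_inr]
    split_ifs <;> simp

theorem abs_queryIndicator_le (i : S × A) (y) : |queryIndicator i y| ≤ 1 := by
  rcases y with u | z
  · simp [queryIndicator]
  · simp only [queryIndicator, Sum.elim_inr]
    split_ifs <;> simp

theorem sum_queryIndicator_le (T : Finset (S × A)) (y) : ∑ i ∈ T, queryIndicator i y ≤ 1 := by
  classical
  rcases y with u | z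
  · simp [queryIndicator]
  · simp only [queryIndicator, Sum.elim_inr, Finset.sum_ite_eq]
    split_ifs <;> simp

theorem abs_logRatio_le (γ : ℝ) (i : S × A) (y) :
    |logRatio γ i y| ≤ |Real.log ((1 + γ) / (1 - γ))| := by
  rcases y with u | z
  · simp [logRatio]
  · simp only [logRatio, Sum.elim_inr]
    split_ifs <;> simp

variable [MeasurableSpace S] [MeasurableSpace A] [MeasurableSingletonClass S]
  [MeasurableSingletonClass A]

theorem measurable_queryIndicator (i : S × A) : Measurable (queryIndicator i) := by
  classical
  exact measurable_zero.sumElim (Measurable.ite (measurable_fst (measurableSet_singleton i))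
    measurable_const measurable_const)

theorem measurable_logRatio (γ : ℝ) (i : S × A) : Measurable (logRatio γ i) := by
  classical
  exact measurable_zero.sumElim (Measurable.ite (measurable_fst (measurableSet_singleton i))
    (Measurable.ite (measurable_snd.snd (measurableSet_singleton 1))
      measurable_const measurable_const) measurable_const)

variable [Fintype S] [Fintype A] {n : ℕ}

/-- Only the reward of `i` differs. As the two means are symmetric about `1 / 2`, the likelihood
ratios at rewards `1` and `0` are `(1 + γ) / (1 - γ)` and its inverse. -/
theorem MDP.lintegral_simulator_armInstance (M : MDP layer A) {h : Fin H} {γ : ℝ} (h0 : 0 < γ)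
    (h1 : γ < 1) {i : S × A} (hi : layer i.1 = h) (q : Unit ⊕ (S × A))
    {f : Unit ⊕ ((S × A) × (S × ℝ)) → ℝ≥0∞} (hf : Measurable f) :
    ∫⁻ y, f y ∂((M.armInstance h γ h0 h1 i).simulator q) =
      ∫⁻ y, ENNReal.ofReal (Real.exp (logRatio γ i y)) * f y
        ∂((M.nullInstance h γ h0 h1).simulator q) := by
  have hl := measurable_logRatio γ i
  have hw : Measurable fun y => ENNReal.ofReal (Real.exp (logRatio γ i y)) * f y := by fun_prop
  rcases q with u | p
  · rw [MDP.simulator_inl, MDP.simulator_inl, lintegral_dirac' _ hf, lintegral_dirac' _ hw]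
    simp [logRatio]
  · rw [MDP.armInstance, MDP.nullInstance, MDP.lintegral_simulator_bandit _ _ _ _ _ hf,
      MDP.lintegral_simulator_bandit _ _ _ _ _ hw]
    refine lintegral_congr fun s => ?_
    by_cases hp : p = i
    · subst hp
      have hpos : 0 < 1 - γ := by linarith
      have hr : 0 < (1 + γ) / (1 - γ) := by positivity
      simp only [hi, if_true, logRatio, Sum.elim_inr, zero_ne_one, if_false, Real.exp_neg,
        Real.exp_log hr]
      rw [← mul_assoc, ← mul_assoc, ← ENNReal.ofReal_mul (by linarith),
        ← ENNReal.ofReal_mul (by linarith)]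
      congr 3
      · field_simp
        ring
      · field_simp
    · simp [hp, logRatio]

/-- Under the null a query to `i` has mean log-ratio `((1 - γ) / 2 - (1 + γ) / 2) * log ((1 + γ) /
(1 - γ))`; the indicator term compensates it, which gives the Wald identity. -/
theorem MDP.integral_simulator_nullInstance (M : MDP layer A) {h : Fin H} {γ : ℝ} (h0 : 0 < γ)
    (h1 : γ < 1) {i : S × A} (hi : layer i.1 = h) (q : Unit ⊕ (S × A)) :
    ∫ y, (logRatio γ i y + γ * Real.log ((1 + γ) / (1 - γ)) * queryIndicator i y)
      ∂((M.nullInstance h γ h0 h1).simulator q) = 0 := by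
  have hm : Measurable fun y => logRatio γ i y +
      γ * Real.log ((1 + γ) / (1 - γ)) * queryIndicator i y :=
    (measurable_logRatio γ i).add ((measurable_queryIndicator i).const_mul _)
  rcases q with u | p
  · rw [MDP.simulator_inl, integral_dirac' _ _ hm.stronglyMeasurable]
    simp [logRatio, queryIndicator]
  · rw [MDP.nullInstance, MDP.integral_simulator_bandit _ _ _ _ _ hm
      (C := |Real.log ((1 + γ) / (1 - γ))| + |γ * Real.log ((1 + γ) / (1 - γ))| * 1)]
    · by_cases hp : p = i
      · subst hp
        simp only [hi, if_true, logRatio, queryIndicator, Sum.elim_inr, zero_ne_one, if_false]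
        rw [← integral_zero S ℝ (μ := (M.trans p.1 p.2).toMeasure)]
        congr 1
        funext s
        ring
      · simp [hp, logRatio, queryIndicator]
    · intro y
      refine (abs_add_le _ _).trans (add_le_add (abs_logRatio_le γ i y) ?_)
      rw [abs_mul]
      gcongr
      exact abs_queryIndicator_le i y

/-- Expected number of queries to the arm `i` in `M`. -/
noncomputable def Learner.expectedQueries (L : Learner S A n) (M : MDP layer A) (i : S × A) : ℝ :=
  ∫ x, ∑ k, queryIndicator i (x.2 k) ∂(L.historyLaw M n)

theorem Learner.integrable_sum_record (L : Learner S A n) (M : MDP layer A)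
    {g : Unit ⊕ ((S × A) × (S × ℝ)) → ℝ} (hg : Measurable g) {C : ℝ} (hC : ∀ y, |g y| ≤ C) :
    Integrable (fun x : History S A n => ∑ k, g (x.2 k)) (L.historyLaw M n) :=
  integrable_finsetSum _ fun k _ => Integrable.of_bound
    (hg.comp ((measurable_pi_apply k).comp measurable_snd)).aestronglyMeasurable C
    (ae_of_all _ fun _ => hC _)

theorem Learner.expectedQueries_nonneg (L : Learner S A n) (M : MDP layer A) (i : S × A) :
    0 ≤ L.expectedQueries M i :=
  integral_nonneg fun _ => Finset.sum_nonneg fun _ _ => queryIndicator_nonneg i _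

theorem Learner.sum_expectedQueries_le (L : Learner S A n) (M : MDP layer A)
    (T : Finset (S × A)) : ∑ i ∈ T, L.expectedQueries M i ≤ n := by
  have hint := fun i => L.integrable_sum_record M (measurable_queryIndicator i)
    (abs_queryIndicator_le i)
  simp only [Learner.expectedQueries]
  rw [← integral_finsetSum _ fun i _ => hint i]
  calc ∫ x : History S A n, ∑ i ∈ T, ∑ k, queryIndicator i (x.2 k) ∂(L.historyLaw M n)
      ≤ ∫ _, (n : ℝ) ∂(L.historyLaw M n) := by
        refine integral_mono (integrable_finsetSum _ fun i _ => hint i) (integrable_const _)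
          fun x => ?_
        dsimp only
        rw [Finset.sum_comm]
        calc ∑ k, ∑ i ∈ T, queryIndicator i (x.2 k) ≤ ∑ _k : Fin n, (1 : ℝ) :=
              Finset.sum_le_sum fun k _ => sum_queryIndicator_le T _
          _ = n := by simp
    _ = n := by simp

instance Learner.isProbabilityMeasure_outputLaw (L : Learner S A n) (M : MDP layer A) :
    IsProbabilityMeasure (L.outputLaw M) := by
  rw [Learner.outputLaw]
  infer_instance

/-- Telling the instance `armInstance` from `nullInstance` takes many queries to the arm `i`. -/
theorem Learner.neg_log_le_expectedQueries (L : Learner S A n) (M : MDP layer A) {h : Fin H}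
    {γ : ℝ} (h0 : 0 < γ) (h1 : γ < 1) {i : S × A} (hi : layer i.1 = h) {δ : ℝ} (hδ : 0 < δ)
    (hδ' : δ < 1 / 2) {B : Set (S → A)} (hB : MeasurableSet B)
    (halt : 1 - δ ≤ (L.outputLaw (M.armInstance h γ h0 h1 i)).real B)
    (hnull : (L.outputLaw (M.nullInstance h γ h0 h1)).real B ≤ 1 / 2) :
    - (1 / 2 * Real.log (4 * δ * (1 - δ))) ≤
      γ * Real.log ((1 + γ) / (1 - γ)) * L.expectedQueries (M.nullInstance h γ h0 h1) i := by
  set θ := Real.log ((1 + γ) / (1 - γ)) with hθ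
  set M₀ := M.nullInstance h γ h0 h1 with hM₀
  have hl := measurable_logRatio γ i
  set Λ : History S A n → ℝ := fun x => ∑ k, logRatio γ i (x.2 k) with hΛdef
  -- The output is randomized, so the test is the conditional probability of `B` given the history,
  -- not an indicator.
  set G : History S A n → ℝ := fun x => (L.output x B).toReal with hGdef
  have hΛm : Measurable Λ := by fun_prop
  have hOm : Measurable fun x => L.output x B := Kernel.measurable_coe _ hB
  have hGm : Measurable G := hOm.ennreal_toReal
  have hΛb : ∀ x, |Λ x| ≤ n * |θ| := fun x => by
    refine (Finset.abs_sum_le_sum_abs _ _).trans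
      ((Finset.sum_le_sum fun k _ => abs_logRatio_le γ i _).trans ?_)
    simp [hθ]
  have hG0 : ∀ x, 0 ≤ G x := fun x => ENNReal.toReal_nonneg
  have hG1 : ∀ x, G x ≤ 1 := fun x => by
    have := ENNReal.toReal_mono ENNReal.one_ne_top (prob_le_one (μ := L.output x) (s := B))
    simpa using this
  have hΛi : Integrable Λ (L.historyLaw M₀ n) := L.integrable_sum_record M₀ hl (abs_logRatio_le γ i)
  have hexpb : ∀ x, Real.exp (Λ x) ≤ Real.exp (n * |θ|) := fun x =>
    Real.exp_le_exp.2 ((le_abs_self _).trans (hΛb x))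
  have hexp : Integrable (fun x => Real.exp (Λ x)) (L.historyLaw M₀ n) :=
    Integrable.of_bound hΛm.exp.aestronglyMeasurable (Real.exp (n * |θ|))
      (ae_of_all _ fun x => by rw [Real.norm_eq_abs, Real.abs_exp]; exact hexpb x)
  have hGi : Integrable G (L.historyLaw M₀ n) :=
    Integrable.of_bound hGm.aestronglyMeasurable 1
      (ae_of_all _ fun x => by rw [Real.norm_eq_abs, abs_of_nonneg (hG0 x)]; exact hG1 x)
  have hGexp : Integrable (fun x => G x * Real.exp (Λ x)) (L.historyLaw M₀ n) :=
    hexp.bdd_mul hGm.aestronglyMeasurable (c := 1)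
      (ae_of_all _ fun x => by rw [Real.norm_eq_abs, abs_of_nonneg (hG0 x)]; exact hG1 x)
  have hchange : ∀ {f : History S A n → ℝ≥0∞}, Measurable f →
      ∫⁻ x, f x ∂(L.historyLaw (M.armInstance h γ h0 h1 i) n) =
        ∫⁻ x, ENNReal.ofReal (Real.exp (Λ x)) * f x ∂(L.historyLaw M₀ n) := fun hf =>
    L.lintegral_historyLaw_eq M₀ (M.armInstance h γ h0 h1 i) rfl hl
      (fun q f hf => M.lintegral_simulator_armInstance h0 h1 hi q hf) n hf
  have htot : ∫ x, Real.exp (Λ x) ∂(L.historyLaw M₀ n) = 1 := by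
    rw [integral_eq_lintegral_of_nonneg_ae (ae_of_all _ fun x => Real.exp_nonneg _)
      hΛm.exp.aestronglyMeasurable]
    have := hchange (f := fun _ => 1) measurable_const
    simp only [lintegral_one, measure_univ, mul_one] at this
    rw [← this, ENNReal.toReal_one]
  have hout : ∀ M' : MDP layer A, L.outputLaw M' B = ∫⁻ x, L.output x B ∂(L.historyLaw M' n) :=
    fun M' => Measure.bind_apply hB (Kernel.aemeasurable _)
  have hP : ∫ x, G x * Real.exp (Λ x) ∂(L.historyLaw M₀ n) =
      (L.outputLaw (M.armInstance h γ h0 h1 i)).real B := by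
    rw [Measure.real, hout, hchange hOm, integral_eq_lintegral_of_nonneg_ae
      (ae_of_all _ fun x => mul_nonneg (hG0 x) (Real.exp_nonneg _)) hGexp.aestronglyMeasurable]
    congr 1
    refine lintegral_congr fun x => ?_
    rw [ENNReal.ofReal_mul (hG0 x), mul_comm, ENNReal.ofReal_toReal (measure_ne_top _ _)]
  have hQ : ∫ x, G x ∂(L.historyLaw M₀ n) = (L.outputLaw M₀).real B := by
    rw [Measure.real, hout]
    exact integral_toReal hOm.aemeasurable (ae_of_all _ fun x => measure_lt_top _ _)
  have hmain := integral_logRatio_le hδ hδ' hΛi hexp hGi hGexp hG0 hG1 htot (hP ▸ halt)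
    (hQ ▸ hnull)
  -- Wald identity: the null mean of `Λ` is `-γ * θ` times the expected number of queries to `i`.
  have hzero := L.integral_sum_record_eq_zero M₀
    (g := fun y => logRatio γ i y + γ * θ * queryIndicator i y)
    (hl.add ((measurable_queryIndicator i).const_mul _)) (C := |θ| + |γ * θ| * 1)
    (fun y => (abs_add_le _ _).trans (add_le_add (abs_logRatio_le γ i y) (by
      rw [abs_mul]
      gcongr
      exact abs_queryIndicator_le i y)))
    (fun q => M.integral_simulator_nullInstance h0 h1 hi q) n
  simp only [Finset.sum_add_distrib, ← Finset.mul_sum] at hzero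
  rw [integral_add hΛi ((L.integrable_sum_record M₀ (measurable_queryIndicator i)
    (abs_queryIndicator_le i)).const_mul _), integral_const_mul] at hzero
  rw [Learner.expectedQueries]
  linarith

/-- In `armInstance`, an `ε`-optimal policy with `ε < γ` has to reach the arm `i`. -/
theorem Learner.IsPAC.le_real_reachingPolicies {L : Learner S A n} {M : MDP layer A}
    (hM : M.IsDeterministic) {h : Fin H} {γ : ℝ} {h0 : 0 < γ} {h1 : γ < 1} {i : S × A}
    {Pol : Set (S → A)} (hi : i ∈ M.reachable Pol h) {ε δ : ℝ} (hε : ε < γ)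
    (hL : L.IsPAC (M.armInstance h γ h0 h1 i) Pol ε δ) :
    1 - δ ≤ (L.outputLaw (M.armInstance h γ h0 h1 i)).real (M.reachingPolicies h i) := by
  classical
  rw [Measure.real, ← ENNReal.ofReal_le_iff_le_toReal (measure_ne_top _ _)]
  refine hL.trans (measure_mono fun π' hπ' => ?_)
  obtain ⟨π, hπ, σ, hσ, rfl⟩ := hi
  by_contra hnot
  have hle := hπ' π hπ
  have hbest : (M.armInstance h γ h0 h1 (σ h, π (σ h))).value π = (1 + γ) / 2 := by
    rw [MDP.armInstance, M.value_bandit_of_ne_zero hM h _ _ hσ, if_pos rfl]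
  have hbad : (M.armInstance h γ h0 h1 (σ h, π (σ h))).value π' ≤ (1 - γ) / 2 := by
    refine M.value_bandit_le hM h _ _ (by linarith) fun p hp => ?_
    rw [if_neg]
    rintro rfl
    exact hnot hp
  linarith

/-- Lower bound on the number of queries of a learner that is PAC for all MDPs. -/
theorem Learner.spanningCapacity_mul_neg_log_le (L : Learner S A n) {Pol : Set (S → A)}
    (hC : 2 ≤ spanningCapacity layer Pol) {ε δ γ : ℝ} (h0 : 0 < γ) (h1 : γ < 1) (hε : ε < γ)
    (hδ : 0 < δ) (hδ' : δ < 1 / 2) (hL : ∀ M : MDP layer A, L.IsPAC M Pol ε δ) :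
    spanningCapacity layer Pol * (- Real.log (4 * δ * (1 - δ))) ≤
      4 * (γ * Real.log ((1 + γ) / (1 - γ))) * n := by
  classical
  obtain ⟨h, M, hM, hcard⟩ := exists_reachable_ncard_eq_spanningCapacity hC
  set T : Finset (S × A) := (M.reachable Pol h).toFinset with hT
  have hTcard : T.card = spanningCapacity layer Pol := by
    rw [hcard, hT, Set.ncard_eq_toFinset_card']
  set M₀ := M.nullInstance h γ h0 h1
  have hmeas : ∀ B : Set (S → A), MeasurableSet B := fun B => B.toFinite.measurableSet
  have hdisj : ∑ i ∈ T, (L.outputLaw M₀).real (M.reachingPolicies h i) ≤ 1 := by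
    rw [← measureReal_biUnion_finset]
    · exact measureReal_le_one
    · intro i _ j _ hij
      exact Set.disjoint_left.2 fun π hπ hπ' => hij (M.eq_of_mem_reachingPolicies hM hπ hπ')
    · exact fun i _ => hmeas _
  -- The arm is selected from null quantities alone; the PAC guarantee is then used only in the
  -- alternative for that arm.
  obtain ⟨i, hiT, hq, hN⟩ := exists_le_half_and_card_mul_le T (hTcard ▸ hC)
    (fun i => (L.outputLaw M₀).real (M.reachingPolicies h i)) (fun i => L.expectedQueries M₀ i)
    (fun _ _ => measureReal_nonneg) (fun i _ => L.expectedQueries_nonneg M₀ i) hdisj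
    (L.sum_expectedQueries_le M₀ T)
  have hi : i ∈ M.reachable Pol h := by simpa [hT] using hiT
  have hkey := L.neg_log_le_expectedQueries M h0 h1 (MDP.layer_eq_of_mem_reachable hi) hδ hδ'
    (hmeas _) ((hL _).le_real_reachingPolicies hM hi hε) hq
  have hθ : 0 ≤ γ * Real.log ((1 + γ) / (1 - γ)) := by
    refine mul_nonneg h0.le (Real.log_nonneg ?_)
    rw [le_div_iff₀ (by linarith)]
    linarith
  rw [hTcard] at hN
  have e1 := mul_le_mul_of_nonneg_left hkey (Nat.cast_nonneg (α := ℝ) (spanningCapacity layer Pol))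
  have e2 := mul_le_mul_of_nonneg_left hN hθ
  linarith

end HardInstances

end AgnosticRL

open AgnosticRL in
theorem mainTheorem4 (ε₀ δ₀ : ℝ) (hε₀ : ε₀ < 1) (hδ₀ : δ₀ < 1 / 2) :
    ∃ c : ℝ, 0 < c ∧
      ∀ (H : ℕ) (S : Type*) (A : Type*) [Fintype S] [Fintype A] [MeasurableSpace S]
        [MeasurableSpace A] [MeasurableSingletonClass S] [MeasurableSingletonClass A]
        (layer : S → Fin H) (Pol : Set (S → A)),
        2 ≤ AgnosticRL.spanningCapacity layer Pol →
        ∀ ε δ : ℝ, 0 < ε → ε ≤ ε₀ → 0 < δ → δ ≤ δ₀ →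
          ENNReal.ofReal
              (c * ((AgnosticRL.spanningCapacity layer Pol : ℝ) / ε ^ 2 * Real.log (1 / δ))) ≤
            ((AgnosticRL.nGen layer Pol Set.univ ε δ : ℕ∞) : ℝ≥0∞) := by
  by_cases hpos : 0 < ε₀ ∧ 0 < δ₀
  swap
  -- Here no `ε` and `δ` are admissible, so any constant works.
  · refine ⟨1, one_pos, fun H S A _ _ _ _ _ _ layer Pol _ ε δ hε hε' hδ hδ' => ?_⟩
    exact absurd ⟨hε.trans_le hε', hδ.trans_le hδ'⟩ hpos
  obtain ⟨hε₀0, hδ₀0⟩ := hpos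
  obtain ⟨c, hc, hlog⟩ := exists_mul_log_le hδ₀0 hδ₀
  -- With this ratio `γ = ρ * ε` exceeds `ε` yet stays at most `(1 + ε₀) / 2 < 1`.
  set ρ : ℝ := (1 + ε₀) / (2 * ε₀) with hρ
  have hρ1 : 1 < ρ := by rw [hρ, one_lt_div (by positivity)]; linarith
  have h1ε : 0 < 1 - ε₀ := by linarith
  refine ⟨c * (1 - ε₀) / (16 * ρ ^ 2), by positivity,
    fun H S A _ _ _ _ _ _ layer Pol hC ε δ hε hε' hδ hδ' => ?_⟩
  set D := spanningCapacity layer Pol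
  set 𝓝 : Set ℕ∞ := {m | ∃ n : ℕ, m = n ∧ ∃ L : Learner S A n,
    ∀ M ∈ (Set.univ : Set (MDP layer A)), L.IsPAC M Pol ε δ}
  change _ ≤ ((sInf 𝓝 : ℕ∞) : ℝ≥0∞)
  -- If no learner succeeds, the infimum is `⊤` and the bound is trivial.
  rcases 𝓝.eq_empty_or_nonempty with he | hne
  · simp [he]
  obtain ⟨n, hn, L, hL⟩ := csInf_mem hne
  rw [hn, ENat.toENNReal_coe, ← ENNReal.ofReal_natCast]
  refine ENNReal.ofReal_le_ofReal ?_
  set γ : ℝ := ρ * ε with hγ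
  have hγ0 : 0 < γ := by positivity
  have hγle : γ ≤ (1 + ε₀) / 2 := by
    calc γ ≤ ρ * ε₀ := mul_le_mul_of_nonneg_left hε' (by linarith)
      _ = (1 + ε₀) / 2 := by rw [hρ]; field_simp
  have hγ1 : γ < 1 := by linarith
  have hmain := L.spanningCapacity_mul_neg_log_le (layer := layer) hC hγ0 hγ1
    (by rw [hγ]; nlinarith : ε < γ) hδ (hδ'.trans_lt hδ₀) fun M => hL M trivial
  have h1γ : 0 < 1 - γ := by linarith
  -- Since `1 - γ ≥ (1 - ε₀) / 2`, the entropy per query is of order `γ ^ 2`, hence of order `ε ^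
  -- 2`.
  have hθ : Real.log ((1 + γ) / (1 - γ)) ≤ 4 * γ / (1 - ε₀) := by
    calc Real.log ((1 + γ) / (1 - γ)) ≤ (1 + γ) / (1 - γ) - 1 :=
          Real.log_le_sub_one_of_pos (by positivity)
      _ = 2 * γ / (1 - γ) := by field_simp; ring
      _ ≤ 4 * γ / (1 - ε₀) := by
          rw [div_le_div_iff₀ h1γ h1ε]
          nlinarith
  have hup : 4 * (γ * Real.log ((1 + γ) / (1 - γ))) * n ≤ 4 * (γ * (4 * γ / (1 - ε₀))) * n := by
    gcongr
  have hlow : (D : ℝ) * (c * Real.log (1 / δ)) ≤ D * (- Real.log (4 * δ * (1 - δ))) := by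
    have := hlog δ hδ hδ'
    gcongr
  have hfin : (D : ℝ) * (c * Real.log (1 / δ)) ≤ 16 * ρ ^ 2 * ε ^ 2 / (1 - ε₀) * n := by
    refine (hlow.trans (hmain.trans hup)).trans_eq ?_
    rw [hγ]
    ring
  calc c * (1 - ε₀) / (16 * ρ ^ 2) * (D / ε ^ 2 * Real.log (1 / δ))
      = (1 - ε₀) / (16 * ρ ^ 2 * ε ^ 2) * (D * (c * Real.log (1 / δ))) := by
        field_simp
    _ ≤ (1 - ε₀) / (16 * ρ ^ 2 * ε ^ 2) * (16 * ρ ^ 2 * ε ^ 2 / (1 - ε₀) * n) := by gcongr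
    _ = n := by field_simp
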